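/- Let $p>2$, $C>0$ and $b>0$. There exists a constant $\bar C>0$, depending only on $(p,C,b)$, such that for every $p'$ with $2\le p'<p$ there is $N\in\mathbb N$, depending only on $(p',p,C,b)$, for which the following holds. Let $\mathbb H$ be a separable real Hilbert space and let $(\boldsymbol X_k)_{k\ge 0}$ be a strictly stationary sequence of $\mathbb H$-valued random variables on a probability space $(\Omega,\mathcal F,\mathbb P)$, with $\boldsymbol X_0\sim\pi$, $\pi(\|\boldsymbol X\|^p):=\int_{\mathbb H}\|x\|^p\,\pi(\mathrm dx)<\infty$ and $\int_{\mathbb H}x\,\pi(\mathrm dx)=0$. Suppose that it is exponentially $\beta$-mixing with these constants, that is, $$\beta(n):=\sup_{k\ge 1}\big\|\mathbb P_{((\boldsymbol X_i)_{0\le i\le k},\,(\boldsymbol X_i)_{i\ge n+k})}-\mathbb P_{(\boldsymbol X_i)_{0\le i\le k}}\times\mathbb P_{(\boldsymbol X_i)_{i\ge n+k}}\big\|_{\mathrm{TV}}\le C e^{-bn}\qquad\text{for all } n\ge 1,$$ where $\mathbb P_{Y}$ is the law of $Y$ and $\|\mu-\nu\|_{\mathrm{TV}}=\sup\{|\mu(f)-\nu(f)|: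 f \text{ bounded continuous},\ \|f\|_\infty\le 1\}$. Then for all $n\ge N$, $$\mathbb E\Big\|\sum_{i=1}^n\boldsymbol X_i\Big\|^{p'}\le \bar C\, n^{p'/2}\,\big(\pi(\|\boldsymbol X\|^p)\big)^{p'/p},$$ where the expectation on the left-hand side is finite. -/

import Mathlib

open MeasureTheory ProbabilityTheory
open scoped BoundedContinuousFunction ENNReal

noncomputable section

/-- The total variation norm `‖μ - ν‖_TV` of the difference of two probability measures:
the supremum of `|μ(f) - ν(f)|` over bounded continuous `f` with `‖f‖_∞ ≤ 1`. -/
def tvNorm {S : Type*} [TopologicalSpace S] [MeasurableSpace S] (μ ν : Measure S) : ℝ≥0∞ :=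
  ⨆ (f : S →ᵇ ℝ) (_ : ‖f‖ ≤ 1), ENNReal.ofReal |(∫ x, f x ∂μ) - ∫ x, f x ∂ν|

/-- The dependence coefficient `β(Y, Z)` of two random variables: the total variation distance
between the joint law of `(Y, Z)` and the product of the laws of `Y` and `Z`. -/
def betaDep {Ω S T : Type*} [MeasurableSpace Ω] [TopologicalSpace S] [MeasurableSpace S]
    [TopologicalSpace T] [MeasurableSpace T] (P : Measure Ω) (Y : Ω → S) (Z : Ω → T) : ℝ≥0∞ :=
  tvNorm (P.map fun ω => (Y ω, Z ω)) ((P.map Y).prod (P.map Z))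

/-- The `β`-mixing coefficient
`β(n) = sup_{k ≥ 1} β((X_i)_{0 ≤ i ≤ k}, (X_i)_{i ≥ n + k})` of a process `(X_i)_{i ≥ 0}`. -/
def betaMixing {Ω H : Type*} [MeasurableSpace Ω] [TopologicalSpace H] [MeasurableSpace H]
    (P : Measure Ω) (X : ℕ → Ω → H) (n : ℕ) : ℝ≥0∞ :=
  ⨆ (k : ℕ) (_ : 1 ≤ k),
    betaDep P (fun ω (i : Fin (k + 1)) => X i ω) (fun ω (j : ℕ) => X (n + k + j) ω)

/-- Strict stationarity: for every `k`, the law of the shifted process `(X_{k+i})_{i ≥ 0}` on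
sequence space is the law of `(X_i)_{i ≥ 0}`. -/
def IsStrictlyStationary {Ω H : Type*} [MeasurableSpace Ω] [MeasurableSpace H]
    (P : Measure Ω) (X : ℕ → Ω → H) : Prop :=
  ∀ k : ℕ, P.map (fun ω (i : ℕ) => X (k + i) ω) = P.map (fun ω (i : ℕ) => X i ω)

end

/-! ### Total variation and unbounded test functions. -/

section TotalVariation

variable {S : Type*} [TopologicalSpace S] [MeasurableSpace S]

/-! Fix `s` with `2 < s < p` and `p' ≤ s`; it suffices to bound the moment of order `s`, since
Jensen's inequality then gives order `p'`. Cut `1, ..., n` into blocks of length `q` and separate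
even from odd blocks, so that distinct blocks of one parity are at least `q` apart. A parity sum is
built one block at a time.

When a block `Z` is added to the sum `Y` so far, the joint law of `(Y, Z)` is replaced by the
product of its marginals. The test function `‖x + y‖ ^ s` is unbounded, but its power `p / s > 1` is
integrable, so truncation gives an error of order `n ^ s * exp (-b q (1 - s / p))`
(`abs_integral_sub_le_of_moment`, `abs_integral_sub_prod_le`). Under the product law the first-order
term of the expansion of `‖x + y‖ ^ s` vanishes because `Z` is centred (`norm_add_rpow_le`,
`integral_norm_add_rpow_prod_le`). The second-order term involves `E ‖Z‖ ^ 2`, which is linear in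
`q` because covariances decay geometrically (`sum_sq_moment_le`).

The moments `a j` of the growing sum therefore satisfy `a (j + 1) ≤ a j + A * a j ^ (1 - 2 / s) + B`
with `A` proportional to `q`. Over about `n / q` steps this yields a leading term of order `n ^ (s /
2)` that does not depend on `q` (`le_of_recursive_rpow`). Taking `q` close to a small power of `n`
makes the contribution of `B` smaller than `n ^ (s / 2)` for large `n` (`exists_block_length`). The
leading constants are uniform in `s ≤ p`, so the choice of `s` affects only `N`. -/

lemma abs_integral_sub_le_of_tvNorm_le {μ ν : Measure S} {ε R : ℝ} (hε : 0 ≤ ε)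
    (h : tvNorm μ ν ≤ ENNReal.ofReal ε) {g : S → ℝ} (hg : Continuous g) (hR : 0 < R)
    (hgR : ∀ x, |g x| ≤ R) : |(∫ x, g x ∂μ) - ∫ x, g x ∂ν| ≤ R * ε := by
  have hb : ∀ x, ‖R⁻¹ * g x‖ ≤ 1 := fun x => by
    rw [norm_mul, Real.norm_eq_abs, Real.norm_eq_abs, abs_of_pos (inv_pos.2 hR),
      inv_mul_le_iff₀ hR, mul_one]
    exact hgR x
  let f : S →ᵇ ℝ := BoundedContinuousFunction.ofNormedAddCommGroup (fun x => R⁻¹ * g x)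
    (continuous_const.mul hg) 1 hb
  have hf : ‖f‖ ≤ 1 := BoundedContinuousFunction.norm_ofNormedAddCommGroup_le _ zero_le_one hb
  have h1 : ENNReal.ofReal |(∫ x, f x ∂μ) - ∫ x, f x ∂ν| ≤ ENNReal.ofReal ε :=
    (le_iSup₂ (f := fun (f : S →ᵇ ℝ) (_ : ‖f‖ ≤ 1) =>
      ENNReal.ofReal |(∫ x, f x ∂μ) - ∫ x, f x ∂ν|) f hf).trans h
  have h2 := (ENNReal.ofReal_le_ofReal_iff hε).1 h1
  have h3 : ∀ ρ : Measure S, ∫ x, f x ∂ρ = R⁻¹ * ∫ x, g x ∂ρ := fun ρ =>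
    integral_const_mul R⁻¹ g
  rw [h3, h3, ← mul_sub, abs_mul, abs_of_pos (inv_pos.2 hR), inv_mul_le_iff₀ hR] at h2
  exact h2

/-- The error vanishes for `|x| ≤ R`; otherwise it is at most `|x| = |x| ^ (1 - r) * |x| ^ r`, and
`1 - r ≤ 0`. -/
lemma abs_sub_clip_le {x R r : ℝ} (hR : 0 < R) (hr : 1 ≤ r) :
    |x - max (-R) (min x R)| ≤ R ^ (1 - r) * |x| ^ r := by
  rcases le_or_gt |x| R with h | h
  · obtain ⟨h1, h2⟩ := abs_le.1 h
    rw [min_eq_left h2, max_eq_right h1, sub_self, abs_zero]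
    positivity
  · have h1 : |x - max (-R) (min x R)| ≤ |x| := by
      rcases le_total 0 x with h0 | h0
      · rw [abs_of_nonneg h0] at h ⊢
        rw [min_eq_right h.le, max_eq_right (by linarith), abs_of_nonneg] <;> linarith
      · rw [abs_of_nonpos h0] at h ⊢
        rw [min_eq_left (by linarith), max_eq_left (by linarith), abs_of_nonpos] <;> linarith
    refine h1.trans ?_
    have hx : 0 < |x| := hR.trans h
    have h2 : |x| ^ (1 - r) ≤ R ^ (1 - r) :=
      Real.rpow_le_rpow_of_nonpos hR h.le (by linarith)
    calc |x| = |x| ^ (1 - r) * |x| ^ r := by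
          rw [← Real.rpow_add hx, sub_add_cancel, Real.rpow_one]
      _ ≤ _ := by gcongr

lemma le_one_add_rpow {x r : ℝ} (hx : 0 ≤ x) (hr : 1 ≤ r) : x ≤ 1 + x ^ r := by
  rcases le_total x 1 with h | h
  · linarith [Real.rpow_nonneg hx r]
  · have := Real.self_le_rpow_of_one_le h hr
    linarith

/-- Integrals of an unbounded continuous function against measures that are close in total
variation are close, provided a moment of order `r > 1` is controlled. -/
lemma abs_integral_sub_le_of_moment [OpensMeasurableSpace S] {μ ν : Measure S}
    [IsProbabilityMeasure μ] [IsProbabilityMeasure ν] {ε A r : ℝ} (hε : 0 < ε) (hr : 1 < r)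
    (h : tvNorm μ ν ≤ ENNReal.ofReal ε) {g : S → ℝ} (hg : Continuous g)
    (hμ : Integrable (fun x => |g x| ^ r) μ) (hν : Integrable (fun x => |g x| ^ r) ν)
    (hμA : ∫ x, |g x| ^ r ∂μ ≤ A) (hνA : ∫ x, |g x| ^ r ∂ν ≤ A) :
    |(∫ x, g x ∂μ) - ∫ x, g x ∂ν| ≤ 3 * (A ^ (1 / r) * ε ^ (1 - 1 / r)) := by
  have hr0 : 0 < r := by linarith
  have hA0 : 0 ≤ A := (integral_nonneg fun x => by positivity).trans hμA
  rcases hA0.eq_or_lt with hA | hA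
  · have hz : ∀ (ρ : Measure S) [IsProbabilityMeasure ρ], Integrable (fun x => |g x| ^ r) ρ →
        ∫ x, |g x| ^ r ∂ρ ≤ A → ∫ x, g x ∂ρ = 0 := by
      intro ρ _ hi hle
      have h0 : ∫ x, |g x| ^ r ∂ρ = 0 :=
        le_antisymm (hle.trans hA.ge) (integral_nonneg fun x => by positivity)
      rw [integral_eq_zero_iff_of_nonneg (fun x => by positivity) hi] at h0
      refine integral_eq_zero_of_ae ?_
      filter_upwards [h0] with x hx
      have := (Real.rpow_eq_zero_iff_of_nonneg (abs_nonneg (g x))).1 hx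
      simpa using this.1
    rw [hz μ hμ hμA, hz ν hν hνA, sub_zero, abs_zero]
    positivity
  -- This level balances the cost `R * ε` of the clipped function against the truncation error `R ^
  -- (1 - r) * A`. Both become `A ^ (1 / r) * ε ^ (1 - 1 / r)`; the factor 3 counts one clipped term
  -- and two truncations.
  · set R : ℝ := (A / ε) ^ (1 / r) with hRdef
    have hR : 0 < R := by positivity
    have hk : Continuous fun x => max (-R) (min (g x) R) := by fun_prop
    have hkb : ∀ x, |max (-R) (min (g x) R)| ≤ R := fun x =>
      abs_le.2 ⟨le_max_left _ _, max_le (by linarith) (min_le_right _ _)⟩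
    have h1 := abs_integral_sub_le_of_tvNorm_le hε.le h hk hR hkb
    have h2 : ∀ (ρ : Measure S) [IsProbabilityMeasure ρ], Integrable (fun x => |g x| ^ r) ρ →
        ∫ x, |g x| ^ r ∂ρ ≤ A →
        |(∫ x, g x ∂ρ) - ∫ x, max (-R) (min (g x) R) ∂ρ| ≤ R ^ (1 - r) * A := by
      intro ρ _ hi hle
      have hgi : Integrable g ρ := by
        refine ((integrable_const (1 : ℝ)).add hi).mono' hg.aestronglyMeasurable ?_
        exact Filter.Eventually.of_forall fun x => le_one_add_rpow (abs_nonneg _) hr.le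
      have hki : Integrable (fun x => max (-R) (min (g x) R)) ρ :=
        (integrable_const R).mono' hk.aestronglyMeasurable
          (Filter.Eventually.of_forall hkb)
      rw [← integral_sub hgi hki]
      calc _ ≤ ∫ x, |g x - max (-R) (min (g x) R)| ∂ρ := abs_integral_le_integral_abs
        _ ≤ ∫ x, R ^ (1 - r) * |g x| ^ r ∂ρ :=
            integral_mono (hgi.sub hki).abs (hi.const_mul _) fun x => abs_sub_clip_le hR hr.le
        _ = R ^ (1 - r) * ∫ x, |g x| ^ r ∂ρ := integral_const_mul _ _
        _ ≤ _ := by gcongr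
    have h3 := h2 μ hμ hμA
    have h4 := h2 ν hν hνA
    have e1 : R * ε = A ^ (1 / r) * ε ^ (1 - 1 / r) := by
      rw [hRdef, Real.div_rpow hA.le hε.le, Real.rpow_sub hε, Real.rpow_one]
      ring
    have e2 : R ^ (1 - r) * A = A ^ (1 / r) * ε ^ (1 - 1 / r) := by
      rw [← e1, Real.rpow_sub hR, Real.rpow_one, hRdef, ← Real.rpow_mul (by positivity),
        one_div_mul_cancel hr0.ne', Real.rpow_one]
      field_simp
    rw [e1] at h1
    rw [e2] at h3 h4
    rw [abs_le] at *
    constructor <;> linarith [h1.1, h1.2, h3.1, h3.2, h4.1, h4.2]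

end TotalVariation

lemma tvNorm_map_le {S T : Type*} [TopologicalSpace S] [MeasurableSpace S] [OpensMeasurableSpace S]
    [TopologicalSpace T] [MeasurableSpace T] [BorelSpace T] {μ ν : Measure S} {φ : S → T}
    (hφ : Continuous φ) (hm : Measurable φ) :
    tvNorm (μ.map φ) (ν.map φ) ≤ tvNorm μ ν := by
  refine iSup₂_le fun f hf => ?_
  have hc : ‖f.compContinuous ⟨φ, hφ⟩‖ ≤ 1 :=
    (BoundedContinuousFunction.norm_le zero_le_one).2 fun x => (f.norm_coe_le_norm _).trans hf
  have key : ∀ ρ : Measure S, ∫ y, f y ∂(ρ.map φ) = ∫ x, f.compContinuous ⟨φ, hφ⟩ x ∂ρ := by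
    intro ρ
    exact integral_map_of_stronglyMeasurable hm f.continuous.measurable.stronglyMeasurable
  rw [key, key]
  exact le_iSup₂ (f := fun (f : S →ᵇ ℝ) (_ : ‖f‖ ≤ 1) =>
      ENNReal.ofReal |(∫ x, f x ∂μ) - ∫ x, f x ∂ν|) _ hc

/-- The joint law and the product law are both pushed forward by `φ × ψ`. Continuity is needed
because the test functions are continuous. This passes from whole past and future to block sums. -/
lemma betaDep_comp_le {Ω S T S' T' : Type*} [MeasurableSpace Ω] {P : Measure Ω}
    [IsProbabilityMeasure P]
    [TopologicalSpace S] [MeasurableSpace S] [TopologicalSpace T] [MeasurableSpace T]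
    [OpensMeasurableSpace (S × T)]
    [TopologicalSpace S'] [MeasurableSpace S'] [TopologicalSpace T'] [MeasurableSpace T']
    [BorelSpace (S' × T')] {Y : Ω → S} {Z : Ω → T} {φ : S → S'} {ψ : T → T'}
    (hY : Measurable Y) (hZ : Measurable Z) (hφ : Continuous φ) (hψ : Continuous ψ)
    (hφm : Measurable φ) (hψm : Measurable ψ) :
    betaDep P (fun ω => φ (Y ω)) (fun ω => ψ (Z ω)) ≤ betaDep P Y Z := by
  have := Measure.isProbabilityMeasure_map (μ := P) hY.aemeasurable
  have := Measure.isProbabilityMeasure_map (μ := P) hZ.aemeasurable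
  have h := tvNorm_map_le (μ := P.map fun ω => (Y ω, Z ω)) (ν := (P.map Y).prod (P.map Z))
    (hφ.prodMap hψ) (hφm.prodMap hψm)
  rw [← Measure.map_prod_map _ _ hφm hψm, Measure.map_map hφm hY, Measure.map_map hψm hZ,
    Measure.map_map (hφm.prodMap hψm) (hY.prodMk hZ)] at h
  exact h

/-! ### Jensen's inequality between moments. -/

section Moments

variable {Ω : Type*} [MeasurableSpace Ω] {P : Measure Ω} [IsProbabilityMeasure P]

lemma integral_le_rpow_integral_rpow {f : Ω → ℝ} {t : ℝ} (ht : 1 ≤ t) (hf0 : ∀ x, 0 ≤ f x)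
    (hf : AEStronglyMeasurable f P) (hi : Integrable (fun x => f x ^ t) P) :
    Integrable f P ∧ ∫ x, f x ∂P ≤ (∫ x, f x ^ t ∂P) ^ (1 / t) := by
  have hfi : Integrable f P := by
    refine ((integrable_const (1 : ℝ)).add hi).mono' hf ?_
    refine Filter.Eventually.of_forall fun x => ?_
    rw [Real.norm_of_nonneg (hf0 x)]
    exact le_one_add_rpow (hf0 x) ht
  refine ⟨hfi, ?_⟩
  have h := (convexOn_rpow ht).map_integral_le (μ := P) (f := f)
    (Real.continuous_rpow_const (by linarith)).continuousOn isClosed_Ici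
    (Filter.Eventually.of_forall hf0) hfi hi
  have h0 : 0 ≤ ∫ x, f x ∂P := integral_nonneg hf0
  rw [Real.le_rpow_inv_iff_of_pos h0 (integral_nonneg fun x => Real.rpow_nonneg (hf0 x) _)
    (by linarith) |>.symm] at h
  simpa using h

lemma integral_rpow_le_rpow_integral {f : Ω → ℝ} {a b : ℝ} (ha : 0 < a) (hab : a ≤ b)
    (hf0 : ∀ x, 0 ≤ f x) (hf : AEMeasurable f P) (hi : Integrable (fun x => f x ^ b) P) :
    Integrable (fun x => f x ^ a) P ∧ ∫ x, f x ^ a ∂P ≤ (∫ x, f x ^ b ∂P) ^ (a / b) := by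
  have e : ∀ x, (f x ^ a) ^ (b / a) = f x ^ b := fun x => by
    rw [← Real.rpow_mul (hf0 x), mul_div_cancel₀ _ ha.ne']
  have h := integral_le_rpow_integral_rpow (P := P) (f := fun x => f x ^ a) (t := b / a)
    ((one_le_div ha).2 hab) (fun x => Real.rpow_nonneg (hf0 x) _)
    (hf.pow_const a).aestronglyMeasurable (by simpa only [e] using hi)
  simpa only [e, one_div_div] using h

end Moments

/-! ### Second-order expansion of powers of the norm. -/

lemma exp_le_one_add_add_sq_mul_exp (z : ℝ) :
    Real.exp z ≤ 1 + z + z ^ 2 * Real.exp |z| := by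
  have h := Complex.norm_exp_sub_sum_le_norm_mul_exp (z : ℂ) 2
  have e : Complex.exp z - ∑ m ∈ Finset.range 2, (z : ℂ) ^ m / m.factorial
      = ((Real.exp z - (1 + z) : ℝ) : ℂ) := by
    simp [Finset.sum_range_succ]
  rw [e, Complex.norm_real, Complex.norm_real, Real.norm_eq_abs, Real.norm_eq_abs, sq_abs] at h
  linarith [le_abs_self (Real.exp z - (1 + z))]

/-- The constant in the second order expansion of `x ↦ ‖x‖ ^ s` for `2 ≤ s ≤ p`. -/
noncomputable def taylorConst (p : ℝ) : ℝ := p + 9 * p ^ 2 * Real.exp (3 * p) + 2 ^ p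

lemma one_le_taylorConst {p : ℝ} (hp : 2 < p) : 1 ≤ taylorConst p := by
  have h2 : 0 ≤ (2 : ℝ) ^ p := by positivity
  have h3 : 0 ≤ 9 * p ^ 2 * Real.exp (3 * p) := by positivity
  unfold taylorConst
  linarith

section Taylor

variable {H : Type*} [NormedAddCommGroup H] [InnerProductSpace ℝ H]

/-- If `‖x‖ < ‖y‖`, every term is dominated by `‖y‖ ^ s`. Otherwise `‖x + y‖ ^ 2 = ‖x‖ ^ 2 * (1 +
t)` with `|t| ≤ 3`, and `(1 + t) ^ (s / 2) ≤ exp (s t / 2)` reduces the claim to the expansion of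
the exponential, which stays valid when `1 + t` is near zero. Only an upper bound is required. -/
lemma norm_add_rpow_le {p s : ℝ} (hs : 2 ≤ s) (hsp : s ≤ p) (x y : H) :
    ‖x + y‖ ^ s ≤ ‖x‖ ^ s + s * (‖x‖ ^ (s - 2) * inner ℝ x y)
      + taylorConst p * (‖x‖ ^ (s - 2) * ‖y‖ ^ 2 + ‖y‖ ^ s) := by
  have hin : |inner ℝ x y| ≤ ‖x‖ * ‖y‖ := abs_real_inner_le_norm x y
  have hexp : 0 ≤ 9 * p ^ 2 * Real.exp (3 * p) := by positivity
  have h2p : 0 ≤ (2 : ℝ) ^ p := by positivity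
  rcases lt_or_ge ‖x‖ ‖y‖ with hxy | hxy
  · have hy : 0 < ‖y‖ := (norm_nonneg x).trans_lt hxy
    have h1 : ‖x + y‖ ^ s ≤ 2 ^ p * ‖y‖ ^ s := by
      calc ‖x + y‖ ^ s ≤ (2 * ‖y‖) ^ s := by
            gcongr
            linarith [norm_add_le x y]
        _ = 2 ^ s * ‖y‖ ^ s := Real.mul_rpow (by norm_num) hy.le
        _ ≤ _ := by gcongr; norm_num
    have h2 : -(s * (‖x‖ ^ (s - 2) * inner ℝ x y)) ≤ p * ‖y‖ ^ s := by
      have : -(‖x‖ ^ (s - 2) * inner ℝ x y) ≤ ‖y‖ ^ s := by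
        calc -(‖x‖ ^ (s - 2) * inner ℝ x y) = ‖x‖ ^ (s - 2) * (-inner ℝ x y) := by ring
          _ ≤ ‖x‖ ^ (s - 2) * (‖x‖ * ‖y‖) := by
              gcongr
              exact (neg_le_abs _).trans hin
          _ ≤ ‖y‖ ^ (s - 2) * (‖y‖ * ‖y‖) := by gcongr
          _ = ‖y‖ ^ s := by
              rw [← sq, ← Real.rpow_natCast, ← Real.rpow_add hy]
              norm_num
      have hy0 : 0 ≤ ‖y‖ ^ s := by positivity
      nlinarith
    have h3 : 0 ≤ ‖x‖ ^ s := by positivity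
    have h4 : 0 ≤ ‖x‖ ^ (s - 2) * ‖y‖ ^ 2 := by positivity
    have h5 : 0 ≤ ‖y‖ ^ s := by positivity
    unfold taylorConst
    nlinarith [mul_nonneg hexp h5, mul_nonneg hexp h4, mul_nonneg h2p h4,
      mul_nonneg (by linarith : (0 : ℝ) ≤ p) h4]
  · rcases (norm_nonneg x).eq_or_lt with hx | hx
    · have hx0 : x = 0 := norm_eq_zero.1 hx.symm
      have hy0 : y = 0 := norm_eq_zero.1 (le_antisymm (hx ▸ hxy) (norm_nonneg y))
      subst hx0 hy0
      have : (0 : ℝ) ^ s = 0 := Real.zero_rpow (by linarith)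
      simp [this]
    set u := ‖x‖ ^ 2 with hu
    have hu0 : 0 < u := by positivity
    set h := 2 * inner ℝ x y + ‖y‖ ^ 2 with hh
    have hsq : ‖x + y‖ ^ 2 = u + h := by rw [norm_add_sq_real]; ring
    set t := h / u with ht
    have htu : u * (1 + t) = u + h := by rw [ht]; field_simp
    have ht1 : 0 ≤ 1 + t := by
      have : 0 ≤ u * (1 + t) := by rw [htu, ← hsq]; positivity
      exact nonneg_of_mul_nonneg_right this hu0
    have hhabs : |h| ≤ 3 * (‖x‖ * ‖y‖) := by
      have : |h| ≤ 2 * |inner ℝ x y| + ‖y‖ ^ 2 := by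
        rw [hh]
        refine (abs_add_le _ _).trans ?_
        rw [abs_mul, abs_of_nonneg (sq_nonneg ‖y‖), abs_two]
      nlinarith [norm_nonneg y]
    have ht3 : |t| ≤ 3 := by
      rw [ht, abs_div, abs_of_pos hu0, div_le_iff₀ hu0, hu]
      nlinarith [norm_nonneg y]
    have hut : u * t ^ 2 ≤ 9 * ‖y‖ ^ 2 := by
      have e : u * t ^ 2 = |h| ^ 2 / u := by rw [ht, sq_abs]; field_simp
      rw [e, div_le_iff₀ hu0]
      calc |h| ^ 2 ≤ (3 * (‖x‖ * ‖y‖)) ^ 2 := by gcongr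
        _ = _ := by rw [hu]; ring
    have hpow : ‖x + y‖ ^ s = ‖x‖ ^ s * (1 + t) ^ (s / 2) := by
      have e1 : ∀ z : H, ‖z‖ ^ s = (‖z‖ ^ 2) ^ (s / 2) := fun z => by
        rw [← Real.rpow_natCast, ← Real.rpow_mul (norm_nonneg z)]
        congr 1
        push_cast
        ring
      rw [e1, e1 x, hsq, ← htu, Real.mul_rpow hu0.le ht1]
    have hr : (1 + t) ^ (s / 2) ≤ 1 + s / 2 * t + p ^ 2 * t ^ 2 * Real.exp (3 * p) := by
      have hst : |s / 2 * t| ≤ 3 * p := by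
        rw [abs_mul, abs_of_nonneg (by linarith : 0 ≤ s / 2)]
        nlinarith [abs_nonneg t]
      calc (1 + t) ^ (s / 2) ≤ Real.exp t ^ (s / 2) := by
            gcongr
            linarith [Real.add_one_le_exp t]
        _ = Real.exp (s / 2 * t) := by rw [← Real.exp_mul, mul_comm]
        _ ≤ 1 + s / 2 * t + (s / 2 * t) ^ 2 * Real.exp |s / 2 * t| :=
            exp_le_one_add_add_sq_mul_exp _
        _ ≤ 1 + s / 2 * t + p ^ 2 * t ^ 2 * Real.exp (3 * p) := by
            rw [mul_pow]
            gcongr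
            linarith
    have hxs : ‖x‖ ^ s = ‖x‖ ^ (s - 2) * u := by
      rw [hu, ← Real.rpow_natCast, ← Real.rpow_add hx]
      norm_num
    have hut1 : u * t = h := by rw [ht]; field_simp
    have hw : 0 ≤ ‖x‖ ^ (s - 2) := by positivity
    have hb : u * (1 + s / 2 * t + p ^ 2 * t ^ 2 * Real.exp (3 * p)) ≤
        u + s * inner ℝ x y + taylorConst p * ‖y‖ ^ 2 := by
      have e : u * (1 + s / 2 * t + p ^ 2 * t ^ 2 * Real.exp (3 * p))
          = u + s / 2 * h + p ^ 2 * Real.exp (3 * p) * (u * t ^ 2) := by rw [← hut1]; ring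
      have h6 : p ^ 2 * Real.exp (3 * p) * (u * t ^ 2)
          ≤ p ^ 2 * Real.exp (3 * p) * (9 * ‖y‖ ^ 2) := by gcongr
      rw [e, hh, taylorConst]
      nlinarith [sq_nonneg ‖y‖, mul_nonneg h2p (sq_nonneg ‖y‖)]
    calc ‖x + y‖ ^ s ≤ ‖x‖ ^ s * (1 + s / 2 * t + p ^ 2 * t ^ 2 * Real.exp (3 * p)) := by
          rw [hpow]; gcongr
      _ = ‖x‖ ^ (s - 2) * (u * (1 + s / 2 * t + p ^ 2 * t ^ 2 * Real.exp (3 * p))) := by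
          rw [hxs]; ring
      _ ≤ ‖x‖ ^ (s - 2) * (u + s * inner ℝ x y + taylorConst p * ‖y‖ ^ 2) := by gcongr
      _ = ‖x‖ ^ s + s * (‖x‖ ^ (s - 2) * inner ℝ x y)
          + taylorConst p * (‖x‖ ^ (s - 2) * ‖y‖ ^ 2) := by rw [hxs]; ring
      _ ≤ _ := by
          have h7 : 0 ≤ taylorConst p := by
            unfold taylorConst
            linarith
          have h8 : 0 ≤ ‖y‖ ^ s := by positivity
          gcongr
          linarith

variable [CompleteSpace H] [SecondCountableTopology H] [MeasurableSpace H] [BorelSpace H]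

/-- Adding an independent centred variable increases the moment of order `s` by second order
terms only. -/
lemma integral_norm_add_rpow_prod_le {p s : ℝ} (hs : 2 ≤ s) (hsp : s ≤ p) {μ ν : Measure H}
    [IsProbabilityMeasure μ] [IsProbabilityMeasure ν]
    (hμ : Integrable (fun x => ‖x‖ ^ s) μ) (hν : Integrable (fun x => ‖x‖ ^ s) ν)
    (h0 : ∫ y, y ∂ν = 0) :
    ∫ z, ‖z.1 + z.2‖ ^ s ∂(μ.prod ν) ≤ ∫ x, ‖x‖ ^ s ∂μ + taylorConst p *
      ((∫ x, ‖x‖ ^ (s - 2) ∂μ) * (∫ y, ‖y‖ ^ 2 ∂ν) + ∫ y, ‖y‖ ^ s ∂ν) := by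
  have hmeas : ∀ ρ : Measure H, AEMeasurable (fun x : H => ‖x‖) ρ := fun ρ =>
    measurable_norm.aemeasurable
  have hlow : ∀ (ρ : Measure H) [IsProbabilityMeasure ρ], Integrable (fun x => ‖x‖ ^ s) ρ →
      ∀ a, 0 ≤ a → a ≤ s → Integrable (fun x => ‖x‖ ^ a) ρ := by
    intro ρ _ hi a ha has
    rcases ha.eq_or_lt with rfl | ha
    · simp
    · exact (integral_rpow_le_rpow_integral ha has (fun x => norm_nonneg x) (hmeas ρ) hi).1
  have hμ2 := hlow μ hμ (s - 2) (by linarith) (by linarith)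
  have hν2 : Integrable (fun y => ‖y‖ ^ 2) ν := by
    simpa using hlow ν hν 2 (by norm_num) hs
  have hν1 : Integrable (fun y : H => y) ν := by
    have := hlow ν hν 1 (by norm_num) (by linarith)
    simp only [Real.rpow_one] at this
    exact (integrable_norm_iff aestronglyMeasurable_id).1 this
  have hμ1 : Integrable (fun x : H => ‖x‖ ^ (s - 2) • x) μ := by
    refine (hlow μ hμ (s - 1) (by linarith) (by linarith)).mono' ?_ ?_
    · exact ((measurable_norm.pow_const _).smul measurable_id).aestronglyMeasurable
    · refine Filter.Eventually.of_forall fun x => ?_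
      rw [norm_smul, Real.norm_of_nonneg (by positivity)]
      rcases (norm_nonneg x).eq_or_lt with hx | hx
      · rw [← hx, mul_zero]
        positivity
      · nth_rw 2 [← Real.rpow_one ‖x‖]
        rw [← Real.rpow_add hx]
        exact le_of_eq (by congr 1; ring)
  have hI1 : Integrable (fun z : H × H => ‖z.1‖ ^ s) (μ.prod ν) := hμ.comp_fst ν
  have hI4 : Integrable (fun z : H × H => ‖z.2‖ ^ s) (μ.prod ν) := hν.comp_snd μ
  have hI3 : Integrable (fun z : H × H => ‖z.1‖ ^ (s - 2) * ‖z.2‖ ^ 2) (μ.prod ν) :=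
    hμ2.mul_prod hν2
  have hI2 : Integrable (fun z : H × H => ‖z.1‖ ^ (s - 2) * inner ℝ z.1 z.2) (μ.prod ν) := by
    have := hμ1.norm.mul_prod hν1.norm
    refine this.mono' ?_ (Filter.Eventually.of_forall fun z => ?_)
    · exact ((measurable_fst.norm.pow_const _).mul
        (measurable_fst.inner measurable_snd)).aestronglyMeasurable
    · rw [norm_mul, norm_smul, mul_assoc]
      gcongr
      exact norm_inner_le_norm z.1 z.2
  have hI12 : Integrable (fun z : H × H => ‖z.1‖ ^ s +
      s * (‖z.1‖ ^ (s - 2) * inner ℝ z.1 z.2)) (μ.prod ν) := hI1.add (hI2.const_mul s)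
  have hI34 : Integrable (fun z : H × H => taylorConst p *
      (‖z.1‖ ^ (s - 2) * ‖z.2‖ ^ 2 + ‖z.2‖ ^ s)) (μ.prod ν) := (hI3.add hI4).const_mul _
  -- Centring enters here: integrating first over `z.2` kills the linear term.
  have hE2 : ∫ z : H × H, ‖z.1‖ ^ (s - 2) * inner ℝ z.1 z.2 ∂(μ.prod ν) = 0 := by
    rw [integral_prod _ hI2]
    refine integral_eq_zero_of_ae (Filter.Eventually.of_forall fun x => ?_)
    simp only [Pi.zero_apply]
    rw [integral_const_mul, integral_inner hν1, h0, inner_zero_right, mul_zero]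
  have hE1 : ∫ z : H × H, ‖z.1‖ ^ s ∂(μ.prod ν) = ∫ x, ‖x‖ ^ s ∂μ := by
    rw [integral_fun_fst (fun x : H => ‖x‖ ^ s)]; simp
  have hE4 : ∫ z : H × H, ‖z.2‖ ^ s ∂(μ.prod ν) = ∫ y, ‖y‖ ^ s ∂ν := by
    rw [integral_fun_snd (fun x : H => ‖x‖ ^ s)]; simp
  have hE3 := integral_prod_mul (μ := μ) (ν := ν) (fun x : H => ‖x‖ ^ (s - 2))
    (fun y : H => ‖y‖ ^ 2)
  calc ∫ z, ‖z.1 + z.2‖ ^ s ∂(μ.prod ν)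
      ≤ ∫ z : H × H, (‖z.1‖ ^ s + s * (‖z.1‖ ^ (s - 2) * inner ℝ z.1 z.2)
        + taylorConst p * (‖z.1‖ ^ (s - 2) * ‖z.2‖ ^ 2 + ‖z.2‖ ^ s)) ∂(μ.prod ν) := by
        refine integral_mono_of_nonneg (Filter.Eventually.of_forall fun z => by positivity) ?_
          (Filter.Eventually.of_forall fun z => norm_add_rpow_le hs hsp z.1 z.2)
        exact hI12.add hI34
    _ = _ := by
        rw [integral_add hI12 hI34,
          integral_add hI1 (hI2.const_mul s), integral_const_mul, integral_const_mul,
          integral_add hI3 hI4, hE1, hE2, hE3, hE4]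
        ring

end Taylor

/-! ### The recursive inequality. -/

/-- Solution of the recursive inequality `a_{j+1} ≤ a_j + A a_j^{1-2/s} + B`. -/
lemma le_of_recursive_rpow {s A B : ℝ} (hs : 2 ≤ s) (hA : 0 ≤ A) (hB : 0 ≤ B) {m : ℕ} {a : ℕ → ℝ}
    (ha : ∀ j, 0 ≤ a j) (h0 : a 0 = 0)
    (hrec : ∀ j < m, a (j + 1) ≤ a j + A * a j ^ (1 - 2 / s) + B) :
    a m ≤ (2 * m * A) ^ (s / 2) + 2 * m * B := by
  -- The sequence need not be monotone, so the argument runs on its maximum `L`, which satisfies `L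
  -- ≤ m * A * L ^ (1 - 2 / s) + m * B`. Whichever term on the right dominates gives one of the two
  -- bounds.
  obtain ⟨k, hk, hmax⟩ := Finset.exists_max_image (Finset.range (m + 1)) a ⟨0, by simp⟩
  set L := a k with hL
  have hle : ∀ j ≤ m, a j ≤ L := fun j hj => hmax j (by simpa using Nat.lt_succ_of_le hj)
  have hs2 : 0 ≤ 1 - 2 / s := by
    rw [sub_nonneg, div_le_one (by linarith)]; exact hs
  have hL0 : 0 ≤ L := ha k
  have hsum : ∀ j ≤ m, a j ≤ j * (A * L ^ (1 - 2 / s) + B) := by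
    intro j
    induction j with
    | zero => intro _; simp [h0]
    | succ j ih =>
      intro hj
      have h1 := hrec j (by omega)
      have h2 : A * a j ^ (1 - 2 / s) ≤ A * L ^ (1 - 2 / s) := by
        have := ha j
        have := hle j (by omega)
        gcongr
      push_cast
      linarith [ih (by omega)]
  have hkm : k ≤ m := by simpa [Nat.lt_succ_iff] using hk
  have hkey : L ≤ m * (A * L ^ (1 - 2 / s) + B) := by
    refine (hsum k hkm).trans ?_
    gcongr
  refine (hle m le_rfl).trans ?_
  have hm0 : (0 : ℝ) ≤ m := by positivity
  have hfirst : 0 ≤ (2 * m * A) ^ (s / 2) := by positivity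
  rcases le_total (m * (A * L ^ (1 - 2 / s))) (m * B) with h | h
  · linarith
  · have h1 : L ≤ 2 * m * A * L ^ (1 - 2 / s) := by linarith
    have h2 : L ≤ (2 * m * A) ^ (s / 2) := by
      rcases hL0.eq_or_lt with hz | hpos
      · rw [← hz]; exact hfirst
      · have h3 : L ^ (2 / s) ≤ 2 * m * A := by
          have hq : 0 < L ^ (1 - 2 / s) := by positivity
          refine le_of_mul_le_mul_right ?_ hq
          rwa [← Real.rpow_add hpos, show 2 / s + (1 - 2 / s) = 1 by ring, Real.rpow_one]
        calc L = (L ^ (2 / s)) ^ (s / 2) := by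
              rw [← Real.rpow_mul hL0, show 2 / s * (s / 2) = 1 by field_simp, Real.rpow_one]
          _ ≤ _ := by gcongr
    have : 0 ≤ 2 * (m : ℝ) * B := by positivity
    linarith

lemma norm_add_rpow_le_two_rpow_mul {H : Type*} [NormedAddCommGroup H] {p : ℝ} (hp : 1 ≤ p)
    (x y : H) : ‖x + y‖ ^ p ≤ 2 ^ (p - 1) * (‖x‖ ^ p + ‖y‖ ^ p) := by
  have h := Real.rpow_sum_le_const_mul_sum_rpow Finset.univ ![‖x‖, ‖y‖] hp
  simp only [Fin.sum_univ_two, Matrix.cons_val_zero, Matrix.cons_val_one, abs_norm,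
    Finset.card_univ, Fintype.card_fin] at h
  refine le_trans ?_ h
  gcongr
  exact norm_add_le x y

/-! ### Partial sums of mixing processes. -/

section PartialSums

variable {Ω H : Type*} [MeasurableSpace Ω] {P : Measure Ω} [IsProbabilityMeasure P]
  [NormedAddCommGroup H] [SecondCountableTopology H] [MeasurableSpace H] [BorelSpace H]

/-- The joint law and the product law have the same marginals, so moments of `Y` and `Z` separately
control `|g| ^ r` under both. -/
lemma abs_integral_sub_prod_le {Y Z : Ω → H} (hY : Measurable Y) (hZ : Measurable Z)
    {p r K A ε : ℝ} (hr : 1 < r) (hε : 0 < ε)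
    (hYp : Integrable (fun ω => ‖Y ω‖ ^ p) P) (hZp : Integrable (fun ω => ‖Z ω‖ ^ p) P)
    (hdep : betaDep P Y Z ≤ ENNReal.ofReal ε) {g : H × H → ℝ} (hg : Continuous g)
    (hgK : ∀ z, |g z| ^ r ≤ K * (‖z.1‖ ^ p + ‖z.2‖ ^ p))
    (hA : K * (∫ ω, ‖Y ω‖ ^ p ∂P + ∫ ω, ‖Z ω‖ ^ p ∂P) ≤ A) :
    |(∫ ω, g (Y ω, Z ω) ∂P) - ∫ z, g z ∂((P.map Y).prod (P.map Z))|
      ≤ 3 * (A ^ (1 / r) * ε ^ (1 - 1 / r)) := by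
  have hYZ : Measurable fun ω => (Y ω, Z ω) := hY.prodMk hZ
  have := Measure.isProbabilityMeasure_map (μ := P) hY.aemeasurable
  have := Measure.isProbabilityMeasure_map (μ := P) hZ.aemeasurable
  have := Measure.isProbabilityMeasure_map (μ := P) hYZ.aemeasurable
  have hn : Measurable fun x : H => ‖x‖ ^ p := measurable_norm.pow_const p
  have hbound : ∀ (ρ : Measure (H × H)) [IsProbabilityMeasure ρ],
      ρ.map Prod.fst = P.map Y → ρ.map Prod.snd = P.map Z →
      Integrable (fun z => |g z| ^ r) ρ ∧ ∫ z, |g z| ^ r ∂ρ ≤ A := by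
    intro ρ _ h1 h2
    have i1 : Integrable (fun z : H × H => ‖z.1‖ ^ p) ρ := by
      have : Integrable (fun x : H => ‖x‖ ^ p) (ρ.map Prod.fst) := by
        rw [h1]
        exact (integrable_map_measure hn.aestronglyMeasurable hY.aemeasurable).2 hYp
      exact this.comp_measurable measurable_fst
    have i2 : Integrable (fun z : H × H => ‖z.2‖ ^ p) ρ := by
      have : Integrable (fun x : H => ‖x‖ ^ p) (ρ.map Prod.snd) := by
        rw [h2]
        exact (integrable_map_measure hn.aestronglyMeasurable hZ.aemeasurable).2 hZp
      exact this.comp_measurable measurable_snd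
    have e1 : ∫ z : H × H, ‖z.1‖ ^ p ∂ρ = ∫ ω, ‖Y ω‖ ^ p ∂P := by
      rw [← integral_map_of_stronglyMeasurable (f := fun x : H => ‖x‖ ^ p) measurable_fst
        hn.stronglyMeasurable, h1, integral_map_of_stronglyMeasurable hY hn.stronglyMeasurable]
    have e2 : ∫ z : H × H, ‖z.2‖ ^ p ∂ρ = ∫ ω, ‖Z ω‖ ^ p ∂P := by
      rw [← integral_map_of_stronglyMeasurable (f := fun x : H => ‖x‖ ^ p) measurable_snd
        hn.stronglyMeasurable, h2, integral_map_of_stronglyMeasurable hZ hn.stronglyMeasurable]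
    have i3 : Integrable (fun z => |g z| ^ r) ρ := by
      refine ((i1.add i2).const_mul K).mono'
        (hg.measurable.abs.pow_const r).aestronglyMeasurable
        (Filter.Eventually.of_forall fun z => ?_)
      rw [Real.norm_of_nonneg (by positivity)]
      exact hgK z
    refine ⟨i3, (integral_mono i3 ((i1.add i2).const_mul K) hgK).trans ?_⟩
    rw [integral_const_mul]
    simp only [Pi.add_apply]
    rwa [integral_add i1 i2, e1, e2]
  obtain ⟨a1, a2⟩ := hbound (P.map fun ω => (Y ω, Z ω))
    (by rw [Measure.map_map measurable_fst hYZ]; rfl)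
    (by rw [Measure.map_map measurable_snd hYZ]; rfl)
  obtain ⟨b1, b2⟩ := hbound ((P.map Y).prod (P.map Z))
    (by rw [← Measure.fst, Measure.fst_prod]) (by rw [← Measure.snd, Measure.snd_prod])
  have h := abs_integral_sub_le_of_moment hε hr hdep hg a1 b1 a2 b2
  rwa [integral_map_of_stronglyMeasurable hYZ hg.measurable.stronglyMeasurable] at h

lemma betaDep_sum_le_betaMixing {X : ℕ → Ω → H} (hX : ∀ i, Measurable (X i)) {q : ℕ}
    {A B : Finset ℕ} (hA : A.Nonempty) (hA1 : ∀ i ∈ A, 1 ≤ i)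
    (hAB : ∀ i ∈ A, ∀ j ∈ B, i + q ≤ j) :
    betaDep P (fun ω => ∑ i ∈ A, X i ω) (fun ω => ∑ i ∈ B, X i ω) ≤ betaMixing P X q := by
  obtain ⟨k, hkA, hk⟩ := Finset.exists_max_image A id hA
  -- Here `k` is the last index of `A`. `Fin.ofNat` is applied only to `i ≤ k` and the subtraction
  -- below only to `j ≥ q + k`, so neither wraps nor truncates. The indices start at 1 because the
  -- mixing coefficient ranges over `k ≥ 1`.
  have hφ : Continuous fun y : Fin (k + 1) → H => ∑ i ∈ A, y (Fin.ofNat (k + 1) i) := by fun_prop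
  have hψ : Continuous fun y : ℕ → H => ∑ j ∈ B, y (j - (q + k)) := by fun_prop
  have h := betaDep_comp_le (P := P) (Y := fun ω (i : Fin (k + 1)) => X i ω)
    (Z := fun ω (j : ℕ) => X (q + k + j) ω) (measurable_pi_lambda _ fun i => hX i)
    (measurable_pi_lambda _ fun i => hX _) hφ hψ hφ.measurable hψ.measurable
  refine le_trans (le_of_eq ?_) (h.trans (le_iSup₂ (f := fun (k : ℕ) (_ : 1 ≤ k) =>
    betaDep P (fun ω (i : Fin (k + 1)) => X i ω) (fun ω (j : ℕ) => X (q + k + j) ω)) k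
    (hA1 k hkA)))
  congr 1
  · funext ω
    refine Finset.sum_congr rfl fun i hi => ?_
    have : i ≤ k := hk i hi
    simp [Fin.ofNat, Nat.mod_eq_of_lt (Nat.lt_succ_of_le this)]
  · funext ω
    refine Finset.sum_congr rfl fun j hj => ?_
    have : k + q ≤ j := hAB k hkA j hj
    simp only [show q + k + (j - (q + k)) = j by omega]

variable [InnerProductSpace ℝ H]

/-- The properties of an exponentially `β`-mixing stationary process used in moment bounds:
centred variables with a common absolute moment `M` of order `p`. -/
structure IsMixingProcess (P : Measure Ω) (X : ℕ → Ω → H) (p C b M : ℝ) : Prop where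
  measurable : ∀ i, Measurable (X i)
  integrable : ∀ i, Integrable (fun ω => ‖X i ω‖ ^ p) P
  moment : ∀ i, ∫ ω, ‖X i ω‖ ^ p ∂P = M
  centered : ∀ i, ∫ ω, X i ω ∂P = 0
  mixing : ∀ n : ℕ, 1 ≤ n → betaMixing P X n ≤ ENNReal.ofReal (C * Real.exp (-b * n))

namespace IsMixingProcess

variable {X : ℕ → Ω → H} {p C b M : ℝ}

lemma moment_nonneg (h : IsMixingProcess P X p C b M) : 0 ≤ M := by
  rw [← h.moment 0]
  exact integral_nonneg fun ω => by positivity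

lemma measurable_sum (h : IsMixingProcess P X p C b M) (A : Finset ℕ) :
    Measurable fun ω => ∑ i ∈ A, X i ω :=
  Finset.measurable_fun_sum A fun i _ => h.measurable i

/-- This crude bound ignores cancellation. It suffices for integrability, for a single block, and
for error terms carrying an exponentially small factor. -/
lemma sum_moment (h : IsMixingProcess P X p C b M) (hp : 1 ≤ p) (A : Finset ℕ) :
    Integrable (fun ω => ‖∑ i ∈ A, X i ω‖ ^ p) P ∧
      ∫ ω, ‖∑ i ∈ A, X i ω‖ ^ p ∂P ≤ (A.card : ℝ) ^ p * M := by
  have hle : ∀ ω, ‖∑ i ∈ A, X i ω‖ ^ p ≤ (A.card : ℝ) ^ (p - 1) * ∑ i ∈ A, ‖X i ω‖ ^ p := by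
    intro ω
    have h1 := Real.rpow_sum_le_const_mul_sum_rpow A (fun i => ‖X i ω‖) hp
    simp only [abs_norm] at h1
    refine le_trans ?_ h1
    gcongr
    exact norm_sum_le _ _
  have hi : Integrable (fun ω => (A.card : ℝ) ^ (p - 1) * ∑ i ∈ A, ‖X i ω‖ ^ p) P :=
    (integrable_finsetSum A fun i _ => h.integrable i).const_mul _
  have hi' : Integrable (fun ω => ‖∑ i ∈ A, X i ω‖ ^ p) P := by
    refine hi.mono' ((h.measurable_sum A).norm.pow_const p).aestronglyMeasurable
      (Filter.Eventually.of_forall fun ω => ?_)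
    rw [Real.norm_of_nonneg (by positivity)]
    exact hle ω
  refine ⟨hi', (integral_mono hi' hi hle).trans (le_of_eq ?_)⟩
  rw [integral_const_mul, integral_finsetSum A fun i _ => h.integrable i]
  simp only [h.moment, Finset.sum_const, nsmul_eq_mul]
  rcases Nat.eq_zero_or_pos A.card with h0 | h0
  · rw [h0]
    simp [Real.zero_rpow (by linarith : p ≠ 0)]
  · have : (0 : ℝ) < A.card := by exact_mod_cast h0
    rw [Real.rpow_sub_one this.ne']
    field_simp

lemma sum_moment_of_le (h : IsMixingProcess P X p C b M) {s : ℝ} (hs : 0 < s) (hsp : s ≤ p)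
    (hp : 1 ≤ p) (A : Finset ℕ) :
    Integrable (fun ω => ‖∑ i ∈ A, X i ω‖ ^ s) P ∧
      ∫ ω, ‖∑ i ∈ A, X i ω‖ ^ s ∂P ≤ (A.card : ℝ) ^ s * M ^ (s / p) := by
  obtain ⟨h1, h2⟩ := h.sum_moment hp A
  obtain ⟨h3, h4⟩ := integral_rpow_le_rpow_integral (f := fun ω => ‖∑ i ∈ A, X i ω‖) hs hsp
    (fun ω => norm_nonneg _) (h.measurable_sum A).norm.aemeasurable h1
  refine ⟨h3, h4.trans ?_⟩
  have hM := h.moment_nonneg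
  calc (∫ ω, ‖∑ i ∈ A, X i ω‖ ^ p ∂P) ^ (s / p) ≤ ((A.card : ℝ) ^ p * M) ^ (s / p) := by
        have : 0 ≤ s / p := by positivity
        gcongr
    _ = _ := by
        rw [Real.mul_rpow (by positivity) hM, ← Real.rpow_mul (by positivity),
          mul_div_cancel₀ _ (by linarith : p ≠ 0)]

lemma integrable_variable (h : IsMixingProcess P X p C b M) (hp : 1 ≤ p) (i : ℕ) :
    Integrable (X i) P := by
  have := (h.sum_moment_of_le one_pos hp hp {i}).1
  simp only [Finset.sum_singleton, Real.rpow_one] at this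
  exact (integrable_norm_iff (h.measurable i).aestronglyMeasurable).1 this

lemma integral_sum (h : IsMixingProcess P X p C b M) (hp : 1 ≤ p) (A : Finset ℕ) :
    ∫ ω, ∑ i ∈ A, X i ω ∂P = 0 := by
  rw [integral_finsetSum A fun i _ => h.integrable_variable hp i]
  simp [h.centered]

lemma sq_moment (h : IsMixingProcess P X p C b M) (hp : 2 < p) (i : ℕ) :
    Integrable (fun ω => ‖X i ω‖ ^ 2) P ∧ ∫ ω, ‖X i ω‖ ^ 2 ∂P ≤ M ^ (2 / p) := by
  have := h.sum_moment_of_le two_pos hp.le (by linarith) {i}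
  simpa using this

lemma integrable_inner (h : IsMixingProcess P X p C b M) (hp : 2 < p) (i j : ℕ) :
    Integrable (fun ω => inner ℝ (X i ω) (X j ω)) P := by
  refine ((h.sq_moment hp i).1.add (h.sq_moment hp j).1).mono'
    ((h.measurable i).inner (h.measurable j)).aestronglyMeasurable
    (Filter.Eventually.of_forall fun ω => ?_)
  refine (norm_inner_le_norm _ _).trans ?_
  simp only [Pi.add_apply]
  nlinarith [sq_nonneg (‖X i ω‖ - ‖X j ω‖), sq_nonneg ‖X i ω‖, sq_nonneg ‖X j ω‖]

variable [CompleteSpace H]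

lemma integral_inner_le (h : IsMixingProcess P X p C b M) (hp : 2 < p) (hC : 0 < C) {i q : ℕ}
    (hi : 1 ≤ i) (hq : 1 ≤ q) :
    ∫ ω, inner ℝ (X i ω) (X (i + q) ω) ∂P
      ≤ 3 * (M ^ (2 / p) * (C * Real.exp (-b * q)) ^ (1 - 2 / p)) := by
  have hdep : betaDep P (X i) (X (i + q)) ≤ ENNReal.ofReal (C * Real.exp (-b * q)) := by
    have := betaDep_sum_le_betaMixing (P := P) h.measurable (q := q) (A := {i}) (B := {i + q})
      (by simp) (by simpa using hi) (by simp)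
    simp only [Finset.sum_singleton] at this
    exact this.trans (h.mixing q hq)
  -- The inner product has a moment of order `p / 2 > 1` by Cauchy–Schwarz, and `K = 1 / 2` comes
  -- from `u * v ≤ (u ^ 2 + v ^ 2) / 2`. Under the product law its mean is zero.
  have hb := abs_integral_sub_prod_le (h.measurable i) (h.measurable (i + q)) (p := p)
    (r := p / 2) (K := 1 / 2) (A := M) (ε := C * Real.exp (-b * q)) (by linarith)
    (by positivity) (h.integrable i) (h.integrable (i + q)) hdep
    (g := fun z => inner ℝ z.1 z.2) (by fun_prop) (fun z => ?_)
    (by rw [h.moment, h.moment]; linarith)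
  · have hzero : ∫ z : H × H, inner ℝ z.1 z.2 ∂((P.map (X i)).prod (P.map (X (i + q)))) = 0 := by
      have hint : ∀ j, Integrable (fun x : H => x) (P.map (X j)) := fun j =>
        (integrable_map_measure aestronglyMeasurable_id (h.measurable j).aemeasurable).2
          (h.integrable_variable (by linarith) j)
      have := Measure.isProbabilityMeasure_map (μ := P) (h.measurable i).aemeasurable
      have := Measure.isProbabilityMeasure_map (μ := P) (h.measurable (i + q)).aemeasurable
      have e := integral_prod_bilin (innerSL ℝ : H →L[ℝ] H →L[ℝ] ℝ) (hint i) (hint (i + q))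
      have e0 : ∫ x, x ∂(P.map (X i)) = 0 := by
        exact (integral_map (h.measurable i).aemeasurable aestronglyMeasurable_id).trans
          (h.centered i)
      rw [e0, map_zero] at e
      exact e
    rw [hzero, sub_zero, one_div_div] at hb
    exact (le_abs_self _).trans hb
  · have h1 : |inner ℝ z.1 z.2| ≤ ‖z.1‖ * ‖z.2‖ := abs_real_inner_le_norm _ _
    have e : ∀ x : H, ‖x‖ ^ p = (‖x‖ ^ (p / 2)) ^ 2 := fun x => by
      rw [← Real.rpow_natCast, ← Real.rpow_mul (norm_nonneg x)]
      congr 1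
      push_cast
      ring
    calc |inner ℝ z.1 z.2| ^ (p / 2) ≤ (‖z.1‖ * ‖z.2‖) ^ (p / 2) := by gcongr
      _ = ‖z.1‖ ^ (p / 2) * ‖z.2‖ ^ (p / 2) := Real.mul_rpow (norm_nonneg _) (norm_nonneg _)
      _ ≤ _ := by
          rw [e, e]
          nlinarith [sq_nonneg (‖z.1‖ ^ (p / 2) - ‖z.2‖ ^ (p / 2))]

end IsMixingProcess

end PartialSums

/-! ### Covariance decay and second moments. -/

/-- With truncated subtraction the exponent is `|j - i|`. It is injective in `j` on each side of
`i`, so each side is dominated by a geometric series. -/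
lemma sum_pow_dist_le {ρ : ℝ} (h0 : 0 ≤ ρ) (h1 : ρ < 1) (A : Finset ℕ) (i : ℕ) :
    ∑ j ∈ A, ρ ^ ((j - i) + (i - j)) ≤ 2 * (1 - ρ)⁻¹ := by
  have hs := summable_geometric_of_lt_one h0 h1
  have key : ∀ (B : Finset ℕ) (f : ℕ → ℕ), Set.InjOn f B → ∑ j ∈ B, ρ ^ f j ≤ (1 - ρ)⁻¹ := by
    intro B f hf
    rw [← tsum_geometric_of_lt_one h0 h1, ← Finset.sum_image (f := fun k => ρ ^ k) hf]
    exact hs.sum_le_tsum _ fun k _ => by positivity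
  rw [← Finset.sum_filter_add_sum_filter_not A (fun j => i ≤ j), two_mul]
  refine add_le_add (key _ _ ?_) (key _ _ ?_) <;>
  · intro x hx y hy hxy
    simp at hx hy hxy
    omega

/-- The constant in the linear growth of the second moments of partial sums. -/
noncomputable def covConst (p C b : ℝ) : ℝ :=
  (1 + 3 * C ^ (1 - 2 / p)) * (2 * (1 - Real.exp (-b * (1 - 2 / p)))⁻¹)

lemma one_le_covConst {p C b : ℝ} (hp : 2 < p) (hC : 0 < C) (hb : 0 < b) : 1 ≤ covConst p C b := by
  have hθ : 0 < 1 - 2 / p := by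
    rw [sub_pos, div_lt_one (by linarith)]; exact hp
  have h1 : Real.exp (-b * (1 - 2 / p)) < 1 := Real.exp_lt_one_iff.2 (by nlinarith)
  have h2 : 1 ≤ (1 - Real.exp (-b * (1 - 2 / p)))⁻¹ :=
    (one_le_inv₀ (by linarith)).2 (by linarith [Real.exp_pos (-b * (1 - 2 / p))])
  have h3 : 0 ≤ C ^ (1 - 2 / p) := by positivity
  unfold covConst
  nlinarith

namespace IsMixingProcess

variable {Ω H : Type*} [MeasurableSpace Ω] {P : Measure Ω} [IsProbabilityMeasure P]
  [NormedAddCommGroup H] [SecondCountableTopology H] [MeasurableSpace H] [BorelSpace H]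
  [InnerProductSpace ℝ H] [CompleteSpace H] {X : ℕ → Ω → H} {p C b M : ℝ}

/-- The summand 1 in the prefactor covers the diagonal `i = j`; the other summand covers the mixing
estimate. -/
lemma integral_inner_le_pow (h : IsMixingProcess P X p C b M) (hp : 2 < p) (hC : 0 < C)
    {i j : ℕ} (hi : 1 ≤ i) (hj : 1 ≤ j) :
    ∫ ω, inner ℝ (X i ω) (X j ω) ∂P ≤ M ^ (2 / p) * ((1 + 3 * C ^ (1 - 2 / p)) *
      Real.exp (-b * (1 - 2 / p)) ^ ((j - i) + (i - j))) := by
  wlog hij : i ≤ j generalizing i j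
  · have := this hj hi (by omega)
    simp only [real_inner_comm, add_comm (i - j)] at this ⊢
    exact this
  obtain ⟨q, rfl⟩ := Nat.exists_eq_add_of_le hij
  rw [show (i + q - i) + (i - (i + q)) = q by omega]
  have hM : 0 ≤ M ^ (2 / p) := Real.rpow_nonneg h.moment_nonneg _
  have hCθ : 0 ≤ C ^ (1 - 2 / p) := by positivity
  rcases Nat.eq_zero_or_pos q with rfl | hq
  · simp only [add_zero, real_inner_self_eq_norm_sq, pow_zero, mul_one]
    nlinarith [(h.sq_moment hp i).2]
  · refine (h.integral_inner_le hp hC hi hq).trans ?_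
    have e : (C * Real.exp (-b * q)) ^ (1 - 2 / p)
        = C ^ (1 - 2 / p) * Real.exp (-b * (1 - 2 / p)) ^ q := by
      rw [Real.mul_rpow hC.le (Real.exp_pos _).le, ← Real.exp_mul, ← Real.exp_nat_mul]
      congr 2
      ring
    rw [e]
    have : 0 ≤ Real.exp (-b * (1 - 2 / p)) ^ q := by positivity
    nlinarith [mul_nonneg hM this]

lemma sum_sq_moment_le (h : IsMixingProcess P X p C b M) (hp : 2 < p) (hC : 0 < C) (hb : 0 < b)
    {A : Finset ℕ} (hA : ∀ i ∈ A, 1 ≤ i) :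
    ∫ ω, ‖∑ i ∈ A, X i ω‖ ^ 2 ∂P ≤ A.card * (covConst p C b * M ^ (2 / p)) := by
  have hθ : 0 < 1 - 2 / p := by
    rw [sub_pos, div_lt_one (by linarith)]; exact hp
  have hρ : Real.exp (-b * (1 - 2 / p)) < 1 := Real.exp_lt_one_iff.2 (by nlinarith)
  have hM : 0 ≤ M ^ (2 / p) := Real.rpow_nonneg h.moment_nonneg _
  have e : ∀ ω, ‖∑ i ∈ A, X i ω‖ ^ 2 = ∑ i ∈ A, ∑ j ∈ A, inner ℝ (X i ω) (X j ω) := fun ω => by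
    rw [← real_inner_self_eq_norm_sq, sum_inner]
    simp only [inner_sum]
  simp only [e]
  rw [integral_finsetSum A fun i _ => integrable_finsetSum A fun j _ => h.integrable_inner hp i j,
    ← nsmul_eq_mul]
  refine Finset.sum_le_card_nsmul _ _ _ fun i hi => ?_
  rw [integral_finsetSum A fun j _ => h.integrable_inner hp i j]
  calc _ ≤ ∑ j ∈ A, M ^ (2 / p) * ((1 + 3 * C ^ (1 - 2 / p)) *
          Real.exp (-b * (1 - 2 / p)) ^ ((j - i) + (i - j))) :=
        Finset.sum_le_sum fun j hj => h.integral_inner_le_pow hp hC (hA i hi) (hA j hj)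
    _ = M ^ (2 / p) * ((1 + 3 * C ^ (1 - 2 / p)) *
          ∑ j ∈ A, Real.exp (-b * (1 - 2 / p)) ^ ((j - i) + (i - j))) := by
        rw [Finset.mul_sum, Finset.mul_sum]
    _ ≤ M ^ (2 / p) * covConst p C b := by
        unfold covConst
        gcongr
        exact sum_pow_dist_le (Real.exp_pos _).le hρ A i
    _ = _ := mul_comm _ _

/-! ### The block recursion. -/

/-- Adding to a partial sum a block that is `q` time steps away. -/
lemma sum_add_moment_le (h : IsMixingProcess P X p C b M) (hC : 0 < C) (hb : 0 < b)
    {s : ℝ} (hs : 2 < s) (hsp : s < p) {n q : ℕ} (hq : 1 ≤ q) {A B : Finset ℕ}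
    (hA : A ⊆ Finset.Icc 1 n) (hB : B ⊆ Finset.Icc 1 n) (hAB : ∀ i ∈ A, ∀ j ∈ B, i + q ≤ j)
    (hBq : B.card ≤ q) :
    ∫ ω, ‖∑ i ∈ A, X i ω + ∑ i ∈ B, X i ω‖ ^ s ∂P ≤ ∫ ω, ‖∑ i ∈ A, X i ω‖ ^ s ∂P
      + taylorConst p * (q * (covConst p C b * M ^ (2 / p)))
        * (∫ ω, ‖∑ i ∈ A, X i ω‖ ^ s ∂P) ^ (1 - 2 / s)
      + M ^ (s / p) * (taylorConst p * (q : ℝ) ^ s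
        + 3 * ((2 * n : ℝ) ^ s * (C * Real.exp (-b * q)) ^ (1 - s / p))) := by
  have hp : 2 < p := hs.trans hsp
  have hD : 1 ≤ taylorConst p := one_le_taylorConst hp
  have hc : 1 ≤ covConst p C b := one_le_covConst hp hC hb
  have hM : 0 ≤ M := h.moment_nonneg
  have hcard : ∀ {A : Finset ℕ}, A ⊆ Finset.Icc 1 n → (A.card : ℝ) ≤ n := fun hA => by
    have := Finset.card_le_card hA
    rw [Nat.card_Icc, Nat.add_sub_cancel] at this
    exact_mod_cast this
  have hBq' : (B.card : ℝ) ≤ q := by exact_mod_cast hBq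
  have ha0 : 0 ≤ ∫ ω, ‖∑ i ∈ A, X i ω‖ ^ s ∂P := integral_nonneg fun ω => by positivity
  have hmB : ∫ ω, ‖∑ i ∈ B, X i ω‖ ^ s ∂P ≤ (q : ℝ) ^ s * M ^ (s / p) := by
    refine (h.sum_moment_of_le (by linarith) hsp.le (by linarith) B).2.trans ?_
    gcongr
  have herr : 0 ≤ 3 * ((2 * n : ℝ) ^ s * (C * Real.exp (-b * q)) ^ (1 - s / p)) := by positivity
  -- An empty `A` has no last index at which to apply mixing, but then the block moment alone is
  -- enough.
  rcases A.eq_empty_or_nonempty with rfl | hAne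
  · have h0 : (0 : ℝ) ^ s = 0 := Real.zero_rpow (by linarith)
    have hs2 : (0 : ℝ) ^ (1 - 2 / s) = 0 := Real.zero_rpow (by
      have : 2 / s < 1 := (div_lt_one (by linarith)).2 hs
      linarith)
    simp only [Finset.sum_empty, zero_add, norm_zero, h0, integral_zero, hs2, mul_zero]
    refine hmB.trans ?_
    rw [mul_comm]
    gcongr
    have : 0 ≤ (q : ℝ) ^ s := by positivity
    nlinarith
  set Y : Ω → H := fun ω => ∑ i ∈ A, X i ω with hYdef
  set Z : Ω → H := fun ω => ∑ i ∈ B, X i ω with hZdef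
  have hY : Measurable Y := h.measurable_sum A
  have hZ : Measurable Z := h.measurable_sum B
  have := Measure.isProbabilityMeasure_map (μ := P) hY.aemeasurable
  have := Measure.isProbabilityMeasure_map (μ := P) hZ.aemeasurable
  have hdep : betaDep P Y Z ≤ ENNReal.ofReal (C * Real.exp (-b * q)) :=
    (betaDep_sum_le_betaMixing h.measurable hAne (fun i hi => (Finset.mem_Icc.1 (hA hi)).1)
      hAB).trans (h.mixing q hq)
  have hmom : ∀ {A : Finset ℕ}, A ⊆ Finset.Icc 1 n →
      ∫ ω, ‖∑ i ∈ A, X i ω‖ ^ p ∂P ≤ (n : ℝ) ^ p * M := fun {A} hA => by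
    refine (h.sum_moment (by linarith) A).2.trans ?_
    have := hcard hA
    gcongr
  -- With `r = p / s`, the power `r` of `‖x + y‖ ^ s` is `‖x + y‖ ^ p`. The strict inequality `s <
  -- p` leaves a positive exponent `1 - s / p` on the mixing rate.
  have htrans := abs_integral_sub_prod_le hY hZ (p := p) (r := p / s) (K := 2 ^ (p - 1))
    (A := (2 * n : ℝ) ^ p * M) (ε := C * Real.exp (-b * q)) ((one_lt_div (by linarith)).2 hsp)
    (by positivity) (h.sum_moment (by linarith) A).1 (h.sum_moment (by linarith) B).1 hdep
    (g := fun z => ‖z.1 + z.2‖ ^ s)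
    ((by fun_prop : Continuous fun z : H × H => ‖z.1 + z.2‖).rpow_const
      fun z => Or.inr (by linarith))
    (fun z => by
      rw [abs_of_nonneg (by positivity), ← Real.rpow_mul (norm_nonneg _),
        mul_div_cancel₀ _ (by linarith : s ≠ 0)]
      exact norm_add_rpow_le_two_rpow_mul (by linarith) z.1 z.2)
    (by
      have h1 := hmom hA
      have h2 := hmom hB
      have e : (2 * n : ℝ) ^ p * M = 2 ^ (p - 1) * ((n : ℝ) ^ p * M + (n : ℝ) ^ p * M) := by
        rw [Real.mul_rpow (by norm_num) (by positivity), Real.rpow_sub_one (by norm_num)]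
        ring
      rw [e]
      gcongr)
  have e1 : ((2 * n : ℝ) ^ p * M) ^ (1 / (p / s)) = (2 * n : ℝ) ^ s * M ^ (s / p) := by
    rw [one_div_div, Real.mul_rpow (by positivity) hM, ← Real.rpow_mul (by positivity),
      mul_div_cancel₀ _ (by linarith : p ≠ 0)]
  rw [e1, one_div_div] at htrans
  have hn : ∀ t : ℝ, StronglyMeasurable fun x : H => ‖x‖ ^ t := fun t =>
    (measurable_norm.pow_const t).stronglyMeasurable
  have hprod := integral_norm_add_rpow_prod_le hs.le hsp.le (μ := P.map Y) (ν := P.map Z)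
    ((integrable_map_measure (hn s).aestronglyMeasurable hY.aemeasurable).2
      (h.sum_moment_of_le (by linarith) hsp.le (by linarith) A).1)
    ((integrable_map_measure (hn s).aestronglyMeasurable hZ.aemeasurable).2
      (h.sum_moment_of_le (by linarith) hsp.le (by linarith) B).1)
    ((integral_map hZ.aemeasurable aestronglyMeasurable_id).trans
      (h.integral_sum (by linarith) B))
  have e2 : ∫ y, ‖y‖ ^ 2 ∂(P.map Z) = ∫ ω, ‖Z ω‖ ^ 2 ∂P :=
    integral_map_of_stronglyMeasurable hZ (measurable_norm.pow_const 2).stronglyMeasurable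
  rw [integral_map_of_stronglyMeasurable hY (hn s), integral_map_of_stronglyMeasurable hZ (hn s),
    integral_map_of_stronglyMeasurable hY (hn (s - 2)), e2] at hprod
  have hsq : ∫ ω, ‖Z ω‖ ^ 2 ∂P ≤ q * (covConst p C b * M ^ (2 / p)) := by
    refine (h.sum_sq_moment_le hp hC hb fun i hi => (Finset.mem_Icc.1 (hB hi)).1).trans ?_
    gcongr
  -- Jensen expresses the lower moment through the moment of order `s`, which closes the recursion.
  have hlow : ∫ ω, ‖Y ω‖ ^ (s - 2) ∂P ≤ (∫ ω, ‖Y ω‖ ^ s ∂P) ^ (1 - 2 / s) := by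
    have := (integral_rpow_le_rpow_integral (P := P) (f := fun ω => ‖Y ω‖) (a := s - 2) (b := s)
      (by linarith) (by linarith) (fun ω => norm_nonneg _) hY.norm.aemeasurable
      (h.sum_moment_of_le (by linarith) hsp.le (by linarith) A).1).2
    rwa [sub_div, div_self (by linarith : s ≠ 0)] at this
  have hmul : (∫ ω, ‖Y ω‖ ^ (s - 2) ∂P) * ∫ ω, ‖Z ω‖ ^ 2 ∂P
      ≤ (∫ ω, ‖Y ω‖ ^ s ∂P) ^ (1 - 2 / s) * (q * (covConst p C b * M ^ (2 / p))) := by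
    have : 0 ≤ ∫ ω, ‖Z ω‖ ^ 2 ∂P := integral_nonneg fun ω => by positivity
    gcongr
  have hfin := mul_le_mul_of_nonneg_left (add_le_add hmul hmB) (by linarith : 0 ≤ taylorConst p)
  have := (abs_le.1 htrans).2
  linarith

/-- The blocks `{i : i / q = j}` of one parity contribute to a partial sum like independent
variables. -/
lemma parity_sum_moment_le (h : IsMixingProcess P X p C b M) (hC : 0 < C) (hb : 0 < b)
    {s : ℝ} (hs : 2 < s) (hsp : s < p) {n q : ℕ} (hq : 1 ≤ q) (hqn : q ≤ n) (e : ℕ) :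
    ∫ ω, ‖∑ i ∈ (Finset.Icc 1 n).filter (fun i => i / q % 2 = e), X i ω‖ ^ s ∂P ≤
      M ^ (s / p) * ((4 * taylorConst p * covConst p C b * n) ^ (s / 2)
        + 4 * n * (taylorConst p * (q : ℝ) ^ s
          + 3 * ((2 * n : ℝ) ^ s * (C * Real.exp (-b * q)) ^ (1 - s / p)))) := by
  have hp : 2 < p := hs.trans hsp
  have hD : 1 ≤ taylorConst p := one_le_taylorConst hp
  have hc : 1 ≤ covConst p C b := one_le_covConst hp hC hb
  have hM : 0 ≤ M := h.moment_nonneg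
  -- `A j` collects the blocks of parity `e` with index below `j`. For `j` of the other parity the
  -- added block is empty, so the recursion may run through all `j ≤ n / q`.
  set A : ℕ → Finset ℕ := fun j =>
    (Finset.Icc 1 n).filter (fun i => i / q % 2 = e ∧ i / q < j) with hAdef
  set E := taylorConst p * (q : ℝ) ^ s
    + 3 * ((2 * n : ℝ) ^ s * (C * Real.exp (-b * q)) ^ (1 - s / p)) with hE
  have hE0 : 0 ≤ E := by positivity
  have hrec := le_of_recursive_rpow (s := s) (m := n / q + 1)
    (A := taylorConst p * (q * (covConst p C b * M ^ (2 / p)))) (B := M ^ (s / p) * E)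
    (a := fun j => ∫ ω, ‖∑ i ∈ A j, X i ω‖ ^ s ∂P) hs.le (by positivity) (by positivity)
    (fun j => integral_nonneg fun ω => by positivity)
    (by simp [hAdef, Real.zero_rpow (by linarith : s ≠ 0)])
    (fun j _ => by
      set B := (Finset.Icc 1 n).filter (fun i => i / q % 2 = e ∧ i / q = j) with hBdef
      have hunion : ∀ ω, ∑ i ∈ A (j + 1), X i ω = ∑ i ∈ A j, X i ω + ∑ i ∈ B, X i ω := by
        intro ω
        have hdisj : Disjoint (A j) B := by
          rw [Finset.disjoint_left]
          intro i hi hi'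
          simp only [hAdef, hBdef, Finset.mem_filter] at hi hi'
          omega
        rw [← Finset.sum_union hdisj]
        congr 1
        ext i
        simp only [hAdef, hBdef, Finset.mem_filter, Finset.mem_union]
        constructor
        · rintro ⟨h1, h2, h3⟩
          rcases Nat.lt_succ_iff_lt_or_eq.1 h3 with h4 | h4
          exacts [Or.inl ⟨h1, h2, h4⟩, Or.inr ⟨h1, h2, h4⟩]
        · rintro (⟨h1, h2, h3⟩ | ⟨h1, h2, h3⟩)
          exacts [⟨h1, h2, by omega⟩, ⟨h1, h2, by omega⟩]
      have hgap : ∀ i ∈ A j, ∀ k ∈ B, i + q ≤ k := by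
        intro i hi k hk
        simp only [hAdef, hBdef, Finset.mem_filter] at hi hk
        -- Equal parity makes distinct block indices differ by at least 2, so a full block separates
        -- them.
        have h1 : i / q + 2 ≤ k / q := by omega
        have h2 := Nat.div_mul_le_self k q
        have h3 : i < (i / q + 1) * q := by
          rw [mul_comm]
          exact Nat.lt_mul_div_succ i hq
        have h4 := Nat.mul_le_mul_right q h1
        nlinarith
      have hcard : B.card ≤ q := by
        have hsub : B ⊆ Finset.Ico (j * q) (j * q + q) := by
          intro i hi
          simp only [hBdef, Finset.mem_filter] at hi
          have h1 := Nat.div_mul_le_self i q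
          have h2 := Nat.lt_mul_div_succ i hq
          rw [hi.2.2] at h1 h2
          rw [Finset.mem_Ico]
          constructor <;> nlinarith
        simpa using Finset.card_le_card hsub
      simp only [hunion]
      exact h.sum_add_moment_le hC hb hs hsp hq (Finset.filter_subset _ _)
        (Finset.filter_subset _ _) hgap hcard)
  have hlast : A (n / q + 1) = (Finset.Icc 1 n).filter (fun i => i / q % 2 = e) := by
    refine Finset.filter_congr fun i hi => ?_
    have : i / q ≤ n / q := Nat.div_le_div_right (Finset.mem_Icc.1 hi).2
    exact ⟨fun h => h.1, fun h => ⟨h, by omega⟩⟩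
  rw [hlast] at hrec
  -- The number of steps times the block length is at most `n + q ≤ 2 * n`; this removes `q` from
  -- the leading term.
  have hm1 : ((n / q + 1 : ℕ) : ℝ) * q ≤ 2 * n := by
    have : (n / q + 1) * q ≤ 2 * n := by
      have := Nat.div_mul_le_self n q
      nlinarith
    exact_mod_cast this
  have hq1 : (1 : ℝ) ≤ q := by exact_mod_cast hq
  have hm2 : ((n / q + 1 : ℕ) : ℝ) ≤ 2 * n := by
    refine le_trans ?_ hm1
    exact le_mul_of_one_le_right (by positivity) hq1
  refine hrec.trans ?_
  have hMs : (M ^ (2 / p)) ^ (s / 2) = M ^ (s / p) := by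
    rw [← Real.rpow_mul hM]
    congr 1
    field_simp
  have hfst : (2 * ((n / q + 1 : ℕ) : ℝ) *
      (taylorConst p * (q * (covConst p C b * M ^ (2 / p))))) ^ (s / 2)
      ≤ M ^ (s / p) * (4 * taylorConst p * covConst p C b * n) ^ (s / 2) := by
    rw [← hMs, ← Real.mul_rpow (by positivity) (by positivity)]
    have hK : 0 ≤ 2 * (taylorConst p * (covConst p C b * M ^ (2 / p))) := by positivity
    have := mul_le_mul_of_nonneg_left hm1 hK
    refine Real.rpow_le_rpow (by positivity) ?_ (by linarith)
    nlinarith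
  have hsnd : 2 * ((n / q + 1 : ℕ) : ℝ) * (M ^ (s / p) * E) ≤ M ^ (s / p) * (4 * n * E) := by
    have hK : 0 ≤ 2 * (M ^ (s / p) * E) := by positivity
    nlinarith [mul_le_mul_of_nonneg_left hm2 hK]
  exact (add_le_add hfst hsnd).trans_eq (mul_add _ _ _).symm

lemma sum_Icc_moment_le (h : IsMixingProcess P X p C b M) (hC : 0 < C) (hb : 0 < b)
    {s : ℝ} (hs : 2 < s) (hsp : s < p) {n q : ℕ} (hq : 1 ≤ q) (hqn : q ≤ n) :
    ∫ ω, ‖∑ i ∈ Finset.Icc 1 n, X i ω‖ ^ s ∂P ≤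
      2 ^ p * (M ^ (s / p) * ((4 * taylorConst p * covConst p C b * n) ^ (s / 2)
        + 4 * n * (taylorConst p * (q : ℝ) ^ s
          + 3 * ((2 * n : ℝ) ^ s * (C * Real.exp (-b * q)) ^ (1 - s / p))))) := by
  have hp : 2 < p := hs.trans hsp
  have h0 := h.parity_sum_moment_le hC hb hs hsp hq hqn 0
  have h1 := h.parity_sum_moment_le hC hb hs hsp hq hqn 1
  set V := M ^ (s / p) * ((4 * taylorConst p * covConst p C b * n) ^ (s / 2)
        + 4 * n * (taylorConst p * (q : ℝ) ^ s
          + 3 * ((2 * n : ℝ) ^ s * (C * Real.exp (-b * q)) ^ (1 - s / p)))) with hV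
  have hV0 : 0 ≤ V := (integral_nonneg fun ω => by positivity).trans h0
  have hi := fun A => (h.sum_moment_of_le (by linarith : 0 < s) hsp.le (by linarith) A).1
  have hsplit : ∀ ω, ∑ i ∈ Finset.Icc 1 n, X i ω
      = ∑ i ∈ (Finset.Icc 1 n).filter (fun i => i / q % 2 = 0), X i ω
        + ∑ i ∈ (Finset.Icc 1 n).filter (fun i => i / q % 2 = 1), X i ω := by
    intro ω
    rw [← Finset.sum_filter_add_sum_filter_not _ (fun i => i / q % 2 = 0)]
    simp only [Nat.mod_two_ne_zero]
  calc ∫ ω, ‖∑ i ∈ Finset.Icc 1 n, X i ω‖ ^ s ∂P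
      ≤ ∫ ω, 2 ^ (s - 1) * (‖∑ i ∈ (Finset.Icc 1 n).filter (fun i => i / q % 2 = 0), X i ω‖ ^ s
        + ‖∑ i ∈ (Finset.Icc 1 n).filter (fun i => i / q % 2 = 1), X i ω‖ ^ s) ∂P := by
        refine integral_mono (hi _) (((hi _).add (hi _)).const_mul _) fun ω => ?_
        simp only [hsplit]
        exact norm_add_rpow_le_two_rpow_mul (by linarith) _ _
    _ = 2 ^ (s - 1) * (∫ ω, ‖∑ i ∈ (Finset.Icc 1 n).filter (fun i => i / q % 2 = 0), X i ω‖ ^ s ∂P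
        + ∫ ω, ‖∑ i ∈ (Finset.Icc 1 n).filter (fun i => i / q % 2 = 1), X i ω‖ ^ s ∂P) := by
        rw [integral_const_mul, integral_add (hi _) (hi _)]
    _ ≤ 2 ^ (s - 1) * (V + V) := by gcongr
    _ = 2 ^ s * V := by rw [Real.rpow_sub_one (by norm_num)]; ring
    _ ≤ 2 ^ p * V := by gcongr; norm_num

end IsMixingProcess

/-! ### Choice of block length and conclusion. -/

/-- With blocks of length `n ^ δ`, `δ` small, the remainder terms are of lower order than
`n ^ (s / 2)`. -/
lemma exists_block_length {s b C D κ : ℝ} (hs : 2 < s) (hb : 0 < b) (hC : 0 < C) (hD : 0 ≤ D)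
    (hκ : 0 < κ) : ∃ N : ℕ, ∀ n : ℕ, N ≤ n → ∃ q : ℕ, 1 ≤ q ∧ q ≤ n ∧
      4 * n * (D * (q : ℝ) ^ s + 3 * ((2 * n : ℝ) ^ s * (C * Real.exp (-b * q)) ^ κ))
        ≤ (n : ℝ) ^ (s / 2) := by
  -- With `δ * s = (s / 2 - 1) / 2`, the term `n * q ^ s` has order `n ^ (s / 2 - (s / 2 - 1) / 2)`,
  -- strictly below `n ^ (s / 2)`. Any `δ > 0` lets the exponential in `n ^ δ` beat the power `n ^
  -- (1 + s / 2)` left after division by `n ^ (s / 2)`.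
  set δ : ℝ := (s / 2 - 1) / (2 * s) with hδdef
  have hδ : 0 < δ := div_pos (by linarith) (by linarith)
  have hδ1 : δ < 1 := by rw [hδdef, div_lt_one (by linarith)]; linarith
  have hδs : δ * s = (s / 2 - 1) / 2 := by rw [hδdef]; field_simp
  have t1 : Filter.Tendsto (fun x : ℝ => x ^ (-((s / 2 - 1) / 2))) Filter.atTop (nhds 0) :=
    tendsto_rpow_neg_atTop (by linarith)
  have t2 : Filter.Tendsto (fun x : ℝ => (x ^ δ) ^ ((1 + s / 2) / δ) *
      Real.exp (-(b * κ) * x ^ δ)) Filter.atTop (nhds 0) :=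
    (tendsto_rpow_mul_exp_neg_mul_atTop_nhds_zero ((1 + s / 2) / δ) (b * κ)
      (by positivity)).comp (tendsto_rpow_atTop hδ)
  have t3 := ((t1.const_mul (4 * D * 2 ^ s)).add (t2.const_mul (12 * 2 ^ s * C ^ κ))).comp
    tendsto_natCast_atTop_atTop
  rw [mul_zero, mul_zero, add_zero] at t3
  obtain ⟨N, hN⟩ := Filter.eventually_atTop.1
    ((t3.eventually (gt_mem_nhds one_pos)).and (Filter.eventually_ge_atTop 1))
  refine ⟨N, fun n hn => ?_⟩
  obtain ⟨hlt, hn1⟩ := hN n hn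
  have hn1' : (1 : ℝ) ≤ n := by exact_mod_cast hn1
  have hn0 : (0 : ℝ) < n := by linarith
  have hone : 1 ≤ (n : ℝ) ^ δ := Real.one_le_rpow hn1' hδ.le
  have hqge : (n : ℝ) ^ δ ≤ ⌈(n : ℝ) ^ δ⌉₊ := Nat.le_ceil _
  have hqle : (⌈(n : ℝ) ^ δ⌉₊ : ℝ) ≤ 2 * (n : ℝ) ^ δ := by
    have := Nat.ceil_lt_add_one (by positivity : 0 ≤ (n : ℝ) ^ δ)
    linarith
  refine ⟨⌈(n : ℝ) ^ δ⌉₊, ?_, ?_, ?_⟩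
  · exact_mod_cast hone.trans hqge
  · rw [Nat.ceil_le]
    calc (n : ℝ) ^ δ ≤ (n : ℝ) ^ (1 : ℝ) := Real.rpow_le_rpow_of_exponent_le hn1' hδ1.le
      _ = n := Real.rpow_one _
  set q : ℝ := (⌈(n : ℝ) ^ δ⌉₊ : ℝ) with hq
  have hq0 : 0 ≤ q := by positivity
  have b1 : q ^ s ≤ 2 ^ s * (n : ℝ) ^ ((s / 2 - 1) / 2) := by
    calc q ^ s ≤ (2 * (n : ℝ) ^ δ) ^ s := by gcongr
      _ = _ := by
        rw [Real.mul_rpow (by norm_num) (by positivity), ← Real.rpow_mul hn0.le, hδs]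
  have b2 : (C * Real.exp (-b * q)) ^ κ ≤ C ^ κ * Real.exp (-(b * κ) * (n : ℝ) ^ δ) := by
    rw [Real.mul_rpow hC.le (Real.exp_pos _).le, ← Real.exp_mul]
    have : 0 < b * κ := by positivity
    gcongr ?_ * Real.exp ?_
    nlinarith
  have b3 : (2 * n : ℝ) ^ s = 2 ^ s * (n : ℝ) ^ s := Real.mul_rpow (by norm_num) hn0.le
  have e1 : n * (n : ℝ) ^ ((s / 2 - 1) / 2)
      = (n : ℝ) ^ (-((s / 2 - 1) / 2)) * (n : ℝ) ^ (s / 2) := by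
    nth_rw 1 [← Real.rpow_one (n : ℝ)]
    rw [← Real.rpow_add hn0, ← Real.rpow_add hn0]
    congr 1
    ring
  have e2 : n * (n : ℝ) ^ s = ((n : ℝ) ^ δ) ^ ((1 + s / 2) / δ) * (n : ℝ) ^ (s / 2) := by
    nth_rw 1 [← Real.rpow_one (n : ℝ)]
    rw [← Real.rpow_mul hn0.le, mul_div_cancel₀ _ hδ.ne', ← Real.rpow_add hn0,
      ← Real.rpow_add hn0]
    congr 1
    ring
  calc 4 * n * (D * q ^ s + 3 * ((2 * n : ℝ) ^ s * (C * Real.exp (-b * q)) ^ κ))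
      ≤ 4 * n * (D * (2 ^ s * (n : ℝ) ^ ((s / 2 - 1) / 2)) + 3 * ((2 ^ s * (n : ℝ) ^ s) *
          (C ^ κ * Real.exp (-(b * κ) * (n : ℝ) ^ δ)))) := by
        rw [b3]
        gcongr
    _ = 4 * D * 2 ^ s * (n * (n : ℝ) ^ ((s / 2 - 1) / 2)) + 12 * 2 ^ s * C ^ κ *
          ((n * (n : ℝ) ^ s) * Real.exp (-(b * κ) * (n : ℝ) ^ δ)) := by ring
    _ = (4 * D * 2 ^ s * (n : ℝ) ^ (-((s / 2 - 1) / 2)) + 12 * 2 ^ s * C ^ κ *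
          (((n : ℝ) ^ δ) ^ ((1 + s / 2) / δ) * Real.exp (-(b * κ) * (n : ℝ) ^ δ)))
          * (n : ℝ) ^ (s / 2) := by rw [e1, e2]; ring
    _ ≤ 1 * (n : ℝ) ^ (s / 2) := by
        gcongr
        exact hlt.le
    _ = _ := one_mul _

/-- A strictly stationary centred process with exponentially decaying `β`-mixing coefficients. -/
lemma IsMixingProcess.of_stationary {Ω H : Type*} [MeasurableSpace Ω] {P : Measure Ω}
    [IsProbabilityMeasure P] [NormedAddCommGroup H] [SecondCountableTopology H]
    [MeasurableSpace H] [BorelSpace H] [InnerProductSpace ℝ H] {X : ℕ → Ω → H} {p C b : ℝ}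
    (hX : ∀ i, Measurable (X i)) (hst : IsStrictlyStationary P X)
    (hmix : ∀ n : ℕ, 1 ≤ n → betaMixing P X n ≤ ENNReal.ofReal (C * Real.exp (-b * n)))
    (hint : Integrable (fun x : H => ‖x‖ ^ p) (P.map (X 0))) (h0 : ∫ x, x ∂(P.map (X 0)) = 0) :
    IsMixingProcess P X p C b (∫ x, ‖x‖ ^ p ∂(P.map (X 0))) := by
  have hlaw : ∀ i, P.map (X i) = P.map (X 0) := by
    intro i
    have h := congrArg (fun μ => Measure.map (fun y : ℕ → H => y 0) μ) (hst i)
    rw [Measure.map_map (measurable_pi_apply 0) (measurable_pi_lambda _ fun j => hX _),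
      Measure.map_map (measurable_pi_apply 0) (measurable_pi_lambda _ fun j => hX _)] at h
    exact h
  have hn : StronglyMeasurable fun x : H => ‖x‖ ^ p :=
    (measurable_norm.pow_const p).stronglyMeasurable
  refine ⟨hX, fun i => ?_, fun i => ?_, fun i => ?_, hmix⟩
  · rw [← hlaw i] at hint
    exact hint.comp_measurable (hX i)
  · rw [← hlaw i, integral_map_of_stronglyMeasurable (hX i) hn]
  · rw [← hlaw i] at h0
    exact (integral_map (hX i).aemeasurable aestronglyMeasurable_id).symm.trans h0

theorem lemma2p2 (p : ℝ) (hp : 2 < p) (C b : ℝ) (hC : 0 < C) (hb : 0 < b) :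
    ∃ Cbar : ℝ, 0 < Cbar ∧ ∀ p' : ℝ, 2 ≤ p' → p' < p → ∃ N : ℕ,
      ∀ (H : Type*) [NormedAddCommGroup H] [InnerProductSpace ℝ H] [CompleteSpace H]
        [TopologicalSpace.SeparableSpace H] [MeasurableSpace H] [BorelSpace H]
        (Ω : Type*) [MeasurableSpace Ω] (P : Measure Ω) [IsProbabilityMeasure P]
        (X : ℕ → Ω → H) (π : Measure H),
        (∀ i, Measurable (X i)) →
        IsStrictlyStationary P X →
        P.map (X 0) = π →
        (∀ n : ℕ, 1 ≤ n → betaMixing P X n ≤ ENNReal.ofReal (C * Real.exp (-b * n))) →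
        Integrable (fun x : H => ‖x‖ ^ p) π →
        ∫ x, x ∂π = 0 →
        ∀ n : ℕ, N ≤ n →
          Integrable (fun ω => ‖∑ i ∈ Finset.Icc 1 n, X i ω‖ ^ p') P ∧
          ∫ ω, ‖∑ i ∈ Finset.Icc 1 n, X i ω‖ ^ p' ∂P
            ≤ Cbar * (n : ℝ) ^ (p' / 2) * (∫ x, ‖x‖ ^ p ∂π) ^ (p' / p) := by
  have hD : 1 ≤ taylorConst p := one_le_taylorConst hp
  have hc : 1 ≤ covConst p C b := one_le_covConst hp hC hb
  set K := 4 * taylorConst p * covConst p C b with hK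
  have hK1 : 1 ≤ K := by nlinarith
  -- This is fixed before `p'`, hence the exponent `p` where `s` would do; `K ≥ 1` makes the
  -- replacement legitimate. The `+ 1` absorbs the remainder terms.
  set Cbar : ℝ := 2 ^ p * (K ^ (p / 2) + 1) with hCbar
  have hCbar1 : 1 ≤ Cbar := by
    have h1 : (1 : ℝ) ≤ 2 ^ p := Real.one_le_rpow (by norm_num) (by linarith)
    have h2 : 0 ≤ K ^ (p / 2) := by positivity
    nlinarith
  refine ⟨Cbar, by linarith, fun p' hp2 hpp => ?_⟩
  -- The midpoint keeps `s > 2` even when `p' = 2`: a gap above 2 is needed for the remainder to be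
  -- of lower order.
  obtain ⟨s, hs, hps, hsp⟩ : ∃ s, 2 < s ∧ p' ≤ s ∧ s < p :=
    ⟨max p' ((2 + p) / 2), lt_max_of_lt_right (by linarith), le_max_left _ _,
      max_lt hpp (by linarith)⟩
  obtain ⟨N, hN⟩ := exists_block_length (D := taylorConst p) (κ := 1 - s / p) hs hb hC
    (by linarith) (by rw [sub_pos, div_lt_one (by linarith)]; exact hsp)
  refine ⟨N, ?_⟩
  intro H _ _ _ _ _ _ Ω _ P _ X π hX hst hπ hmix hint h0 n hn
  subst hπ
  have : SecondCountableTopology H := UniformSpace.secondCountable_of_separable H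
  have h := IsMixingProcess.of_stationary hX hst hmix hint h0
  set M := ∫ x, ‖x‖ ^ p ∂(P.map (X 0)) with hM
  have hM0 : 0 ≤ M := h.moment_nonneg
  obtain ⟨q, hq, hqn, hrem⟩ := hN n hn
  have hmain : ∫ ω, ‖∑ i ∈ Finset.Icc 1 n, X i ω‖ ^ s ∂P
      ≤ Cbar * (n : ℝ) ^ (s / 2) * M ^ (s / p) := by
    refine (h.sum_Icc_moment_le hC hb hs hsp hq hqn).trans ?_
    have hlead : (K * n) ^ (s / 2) ≤ K ^ (p / 2) * (n : ℝ) ^ (s / 2) := by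
      rw [Real.mul_rpow (by positivity) (by positivity)]
      gcongr
    calc _ ≤ 2 ^ p * (M ^ (s / p) * (K ^ (p / 2) * (n : ℝ) ^ (s / 2) + (n : ℝ) ^ (s / 2))) := by
          gcongr
      _ = _ := by rw [hCbar]; ring
  obtain ⟨hi, hle⟩ := integral_rpow_le_rpow_integral
    (f := fun ω => ‖∑ i ∈ Finset.Icc 1 n, X i ω‖) (by linarith : 0 < p') hps
    (fun ω => norm_nonneg _) (h.measurable_sum _).norm.aemeasurable
    (h.sum_moment_of_le (by linarith) hsp.le (by linarith) _).1
  refine ⟨hi, hle.trans ?_⟩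
  have hs0 : s ≠ 0 := by linarith
  have hps0 : 0 ≤ p' / s := by positivity
  calc (∫ ω, ‖∑ i ∈ Finset.Icc 1 n, X i ω‖ ^ s ∂P) ^ (p' / s)
      ≤ (Cbar * (n : ℝ) ^ (s / 2) * M ^ (s / p)) ^ (p' / s) := by
        gcongr
    _ = Cbar ^ (p' / s) * (n : ℝ) ^ (p' / 2) * M ^ (p' / p) := by
        rw [Real.mul_rpow (by positivity) (by positivity), Real.mul_rpow (by positivity)
          (by positivity), ← Real.rpow_mul (by positivity), ← Real.rpow_mul hM0,
          show s / 2 * (p' / s) = p' / 2 by field_simp, show s / p * (p' / s) = p' / p by field_simp]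
    -- Since `Cbar ≥ 1` and `p' / s ≤ 1`, Jensen does not enlarge the constant.
    _ ≤ Cbar * (n : ℝ) ^ (p' / 2) * M ^ (p' / p) := by
        gcongr
        calc Cbar ^ (p' / s) ≤ Cbar ^ (1 : ℝ) :=
              Real.rpow_le_rpow_of_exponent_le hCbar1 ((div_le_one (by linarith)).2 hps)
          _ = Cbar := Real.rpow_one _
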